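/- There exists an absolute constant $c>0$ such that for every integer $n\ge 1$ and every polytope $P\subset\mathbb{R}^n$ (that is, the convex hull of finitely many points with non-empty interior) which is centrally symmetric (meaning $P=-P$), $$\log|V|\cdot\log|\mathcal{F}|\;\ge\; c\,n,$$ where $V$ and $\mathcal{F}$ denote the sets of vertices ($0$-dimensional faces) and facets ($(n-1)$-dimensional faces) of $P$, respectively, and $\log$ is the natural logarithm. -/

import Mathlib

open scoped Pointwise

/-- A polytope in `ℝⁿ`: the convex hull of finitely many points, with non-empty interior. -/
def IsPolytope {n : ℕ} (P : Set (EuclideanSpace ℝ (Fin n))) : Prop :=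
  (∃ s : Set (EuclideanSpace ℝ (Fin n)), s.Finite ∧ P = convexHull ℝ s) ∧ (interior P).Nonempty

/-- The non-empty faces of `P`: the non-empty sets of all points of `P` at which some linear
functional attains its maximum over `P` (the zero functional gives `P` itself). -/
def IsPolytopeFace {n : ℕ} (P F : Set (EuclideanSpace ℝ (Fin n))) : Prop :=
  F.Nonempty ∧ IsExposed ℝ P F

/-- The dimension of a (non-empty) set: the dimension of its affine hull. -/
noncomputable def faceDim {n : ℕ} (F : Set (EuclideanSpace ℝ (Fin n))) : ℕ :=
  Module.finrank ℝ (vectorSpan ℝ F)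

/-- The vertices of `P`: the points `v` such that `{v}` is a face of `P`. -/
def polytopeVertices {n : ℕ} (P : Set (EuclideanSpace ℝ (Fin n))) :
    Set (EuclideanSpace ℝ (Fin n)) :=
  {v | IsPolytopeFace P {v}}

/-- The facets of `P ⊆ ℝⁿ`: the faces of dimension `n - 1`. -/
def polytopeFacets {n : ℕ} (P : Set (EuclideanSpace ℝ (Fin n))) :
    Set (Set (EuclideanSpace ℝ (Fin n))) :=
  {F | IsPolytopeFace P F ∧ faceDim F + 1 = n}

/-- The vertices are exactly the (elements of the) faces of dimension `0`. -/
theorem isPolytopeFace_and_faceDim_eq_zero_iff {n : ℕ}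
    (P F : Set (EuclideanSpace ℝ (Fin n))) :
    (IsPolytopeFace P F ∧ faceDim F = 0) ↔ ∃ v ∈ polytopeVertices P, F = {v} := by
  constructor
  · rintro ⟨hF, h0⟩
    obtain ⟨v, hv⟩ := hF.1
    have hbot : vectorSpan ℝ F = ⊥ := Submodule.finrank_eq_zero.mp h0
    have hs : F = {v} := by
      refine Set.eq_singleton_iff_unique_mem.mpr ⟨hv, fun x hx => ?_⟩
      have h := vsub_mem_vectorSpan ℝ hx hv
      rw [hbot, Submodule.mem_bot] at h
      exact vsub_eq_zero_iff_eq.mp h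
    subst hs
    exact ⟨v, hF, rfl⟩
  · rintro ⟨v, hv, rfl⟩
    exact ⟨hv, by simp [faceDim]⟩

/-! Let `V` be the vertices of `P` and `U` those of its polar. Each `u ∈ U` cuts out a facet `⟪x, u⟫
= 1`, and distinct `u` give distinct facets, so it suffices to bound `log |V| * log |U|` from below.
Symmetry gives `|⟪v, u⟫| ≤ 1`.

By polarity, `p ⬝ᵥ v ≤ a` on `V` and `q ⬝ᵥ u ≤ b` on `U` force `p ⬝ᵥ q ≤ a * b`. John's theorem
(`exists_john_matrix`) supplies `T` with `|Tᵀ u| ≤ 1` and `|T⁻¹ v| ≤ √n`. For a sign vector `ε` put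
`p = (T⁻¹)ᵀ ε` and `q = T ε`; then `p ⬝ᵥ q = |ε|² = n` whatever `ε` is. Sub-Gaussian bounds
(`exists_sign_dotProduct_le`) give an `ε` with `a = 2 √n √(log |V|)` and `b = 2 √(log |U|)`. Hence
`n ≤ 4 √n √(log |V| log |U|)`, and squaring gives the constant `1/16`. -/

open Matrix
open scoped RealInnerProductSpace

/-! ### John's ellipsoid. -/

open scoped MatrixOrder in
/-- John's theorem in matrix form: some ellipsoid `T '' ball` contained in the polar of `U`
contains `V` after dilation by the square root of the dimension. -/
theorem exists_john_matrix {ι : Type*} [Fintype ι] [DecidableEq ι] (U V : Finset (ι → ℝ))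
    (hVU : ∀ v ∈ V, ∀ u ∈ U, (v ⬝ᵥ u) ^ 2 ≤ 1)
    (hb : ∃ C : ℝ, ∀ q : ι → ℝ, (∀ u ∈ U, q ⬝ᵥ u ≤ 1) → ∀ i, |q i| ≤ C) :
    ∃ T : Matrix ι ι ℝ, IsUnit T.det ∧ (∀ u ∈ U, (Tᵀ *ᵥ u) ⬝ᵥ (Tᵀ *ᵥ u) ≤ 1) ∧
      ∀ v ∈ V, (T⁻¹ *ᵥ v) ⬝ᵥ (T⁻¹ *ᵥ v) ≤ Fintype.card ι := by
  obtain ⟨C, hC⟩ := hb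
  let S : Set (Matrix ι ι ℝ) := {T | ∀ u ∈ U, (Tᵀ *ᵥ u) ⬝ᵥ (Tᵀ *ᵥ u) ≤ 1}
  have hclosed : IsClosed S := by
    have : S = ⋂ u ∈ U, {T : Matrix ι ι ℝ | (Tᵀ *ᵥ u) ⬝ᵥ (Tᵀ *ᵥ u) ≤ 1} := by
      ext T; simp [S]
    rw [this]
    refine isClosed_biInter fun u _ => isClosed_le ?_ continuous_const
    fun_prop
  -- Each column of an admissible `T` lies in the polar of `U`, which is bounded.
  have hsub : S ⊆ Set.pi Set.univ fun _ : ι => Set.pi Set.univ fun _ : ι => Set.Icc (-C) C := by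
    intro T hT i _ j _
    refine abs_le.mp (hC (fun i => T i j) (fun u hu => ?_) i)
    have h := hT u hu
    have h1 : ((Tᵀ *ᵥ u) j) ^ 2 ≤ 1 := by
      refine le_trans ?_ h
      rw [sq]
      exact Finset.single_le_sum (f := fun i => (Tᵀ *ᵥ u) i * (Tᵀ *ᵥ u) i)
        (fun i _ => mul_self_nonneg _) (Finset.mem_univ j)
    exact (abs_le.mp ((sq_le_one_iff_abs_le_one _).mp h1)).2
  have hcomp : IsCompact S :=
    (isCompact_univ_pi fun _ => isCompact_univ_pi fun _ => isCompact_Icc).of_isClosed_subset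
      hclosed hsub
  obtain ⟨δ, hδ, hδS⟩ : ∃ δ : ℝ, 0 < δ ∧ δ • (1 : Matrix ι ι ℝ) ∈ S := by
    have hM : ∀ u ∈ U, u ⬝ᵥ u ≤ ∑ u ∈ U, u ⬝ᵥ u := fun u hu =>
      Finset.single_le_sum (f := fun u : ι → ℝ => u ⬝ᵥ u)
        (fun u _ => Finset.sum_nonneg fun i _ => mul_self_nonneg _) hu
    have h0 : 0 ≤ ∑ u ∈ U, u ⬝ᵥ u :=
      Finset.sum_nonneg fun u _ => Finset.sum_nonneg fun i _ => mul_self_nonneg _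
    set M := ∑ u ∈ U, u ⬝ᵥ u
    refine ⟨1 / (1 + M), by positivity, fun u hu => ?_⟩
    have h1 := hM u hu
    simp only [transpose_smul, transpose_one, smul_mulVec, one_mulVec, smul_dotProduct,
      dotProduct_smul, smul_eq_mul]
    rw [← mul_assoc, div_mul_div_comm, one_mul, div_mul_eq_mul_div, one_mul, div_le_one (by positivity)]
    nlinarith
  obtain ⟨T, hT, hmax⟩ := hcomp.exists_isMaxOn ⟨_, hδS⟩
    (f := fun T : Matrix ι ι ℝ => T.det ^ 2) (by fun_prop)
  have hdet : 0 < T.det ^ 2 := by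
    refine lt_of_lt_of_le ?_ (hmax hδS)
    simp only [det_smul, det_one, mul_one]
    positivity
  have hunit : IsUnit T.det := by
    rw [isUnit_iff_ne_zero]
    rintro h
    simp [h] at hdet
  refine ⟨T, hunit, hT, fun v hv => ?_⟩
  by_contra! hlt
  set w := T⁻¹ *ᵥ v with hw
  set s := w ⬝ᵥ w with hs
  set n : ℝ := (Fintype.card ι : ℝ) with hn
  -- The right side is `1 + t (s - n) + O(t²)`, so a small `t` works when `s > n`; Bernoulli's
  -- inequality makes `t = (s - n) / (2 n s)` explicit.
  obtain ⟨t, ht0, ht1, ht⟩ : ∃ t : ℝ, 0 < t ∧ t < 1 ∧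
      1 < (1 - t) ^ Fintype.card ι * (1 + t / (1 - t) * s) := by
    rcases isEmpty_or_nonempty ι with hι | hι
    · simp [hs, dotProduct, hn] at hlt
    obtain ⟨m, hm⟩ : ∃ m, Fintype.card ι = m + 1 := ⟨_, (Nat.succ_pred Fintype.card_ne_zero).symm⟩
    have hnm : n = m + 1 := by rw [hn, hm]; push_cast; ring
    have hm0 : (0 : ℝ) ≤ m := Nat.cast_nonneg m
    have hs1 : 0 < s := by linarith
    have hpos : 0 < 2 * (n * s) := by rw [hnm]; positivity
    refine ⟨(s - n) / (2 * (n * s)), div_pos (by linarith) hpos, ?_, ?_⟩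
    · rw [div_lt_one hpos]; nlinarith
    set t := (s - n) / (2 * (n * s)) with ht
    have ht0 : 0 < t := div_pos (by linarith) hpos
    have hts : t * (2 * (n * s)) = s - n := by rw [ht, div_mul_cancel₀ _ hpos.ne']
    have ht1 : t < 1 := by rw [ht, div_lt_one hpos]; nlinarith
    have h1 : (1 - t) ^ Fintype.card ι * (1 + t / (1 - t) * s) =
        (1 - t) ^ m * (1 + t * (s - 1)) := by
      have : 1 - t ≠ 0 := by linarith
      rw [hm, pow_succ]; field_simp; ring
    rw [h1]
    have h2 : 1 - m * t ≤ (1 - t) ^ m := by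
      have := one_add_mul_le_pow (a := -t) (by linarith) m
      simpa [sub_eq_add_neg] using this
    have h3 : 0 ≤ 1 + t * (s - 1) := by nlinarith
    refine lt_of_lt_of_le ?_ (mul_le_mul_of_nonneg_right h2 h3)
    have h4 : (m : ℝ) * (s - 1) < 2 * (n * s) := by rw [hnm]; nlinarith
    have h5 : t * (m * (s - 1)) < s - n := by rw [← hts]; exact mul_lt_mul_of_pos_left h4 ht0
    have : (1 - m * t) * (1 + t * (s - 1)) = 1 + t * ((s - n) - t * (m * (s - 1))) := by
      rw [hnm]; ring
    rw [this]
    have := mul_pos ht0 (sub_pos.mpr h5)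
    linarith
  -- If `|w|² > n`, stretching the ellipsoid towards `v` and shrinking it slightly elsewhere keeps
  -- it admissible, because `(v ⬝ᵥ u)² ≤ 1`, but increases the determinant. A factor `Bᵀ * B` of
  -- this matrix turns `T` into the competitor `T * Bᵀ`.
  have hpsd : ((1 - t) • (1 : Matrix ι ι ℝ) + t • vecMulVec w w).PosSemidef := by
    refine (PosSemidef.one.smul (by linarith)).add (PosSemidef.smul ?_ ht0.le)
    simpa using posSemidef_vecMulVec_self_star w
  obtain ⟨B, hB⟩ := CStarAlgebra.nonneg_iff_eq_star_mul_self.mp (nonneg_iff_posSemidef.mpr hpsd)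
  rw [star_eq_conjTranspose, conjTranspose_eq_transpose_of_trivial] at hB
  have hTB : T * Bᵀ ∈ S := by
    intro u hu
    have h1 : ((T * Bᵀ)ᵀ *ᵥ u) ⬝ᵥ ((T * Bᵀ)ᵀ *ᵥ u) =
        (Tᵀ *ᵥ u) ⬝ᵥ ((Bᵀ * B) *ᵥ (Tᵀ *ᵥ u)) := by
      simp only [transpose_mul, transpose_transpose, ← mulVec_mulVec]
      rw [dotProduct_mulVec _ Bᵀ, vecMul_transpose]
    have h2 : w ⬝ᵥ (Tᵀ *ᵥ u) = v ⬝ᵥ u := by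
      rw [dotProduct_mulVec, vecMul_transpose, hw, mulVec_mulVec, mul_nonsing_inv _ hunit,
        one_mulVec]
    rw [h1, ← hB]
    simp only [add_mulVec, smul_mulVec, one_mulVec, vecMulVec_mulVec, dotProduct_add,
      dotProduct_smul, smul_eq_mul]
    have h3 : (Tᵀ *ᵥ u) ⬝ᵥ w = v ⬝ᵥ u := by rw [dotProduct_comm, h2]
    have h4 := hT u hu
    have h5 := hVU v hv u hu
    simp [h2, h3]
    nlinarith
  have h1 := hmax hTB
  simp only [Set.mem_ofPred_eq, det_mul, mul_pow] at h1
  have h2 : Bᵀ.det ^ 2 = (1 - t) ^ Fintype.card ι * (1 + t / (1 - t) * s) := by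
    have h3 : Bᵀ.det ^ 2 = (Bᵀ * B).det := by rw [det_mul, det_transpose, sq]
    have h4 : (1 - t) • (1 : Matrix ι ι ℝ) + t • vecMulVec w w =
        (1 - t) • (1 + vecMulVec ((t / (1 - t)) • w) w) := by
      rw [smul_add, smul_vecMulVec, smul_smul, mul_div_cancel₀ _ (by linarith : 1 - t ≠ 0)]
    rw [h3, ← hB, h4, det_smul]
    congr 1
    rw [vecMulVec_eq Unit, det_one_add_replicateCol_mul_replicateRow]
    simp [hs]
  rw [h2] at h1
  nlinarith

/-! ### Exponential moments of random signs. -/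

/-- Independence factors the sum into hyperbolic cosines, and `cosh x ≤ exp (x² / 2)`. -/
theorem sum_exp_sign_le {ι : Type*} [Fintype ι] [DecidableEq ι] (a : ι → ℝ) :
    ∑ ε ∈ Fintype.piFinset (fun _ : ι => ({1, -1} : Finset ℝ)), Real.exp (ε ⬝ᵥ a) ≤
      2 ^ Fintype.card ι * Real.exp ((a ⬝ᵥ a) / 2) := by
  have h1 : ∑ ε ∈ Fintype.piFinset (fun _ : ι => ({1, -1} : Finset ℝ)), Real.exp (ε ⬝ᵥ a) =
      ∏ i, ∑ x ∈ ({1, -1} : Finset ℝ), Real.exp (x * a i) := by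
    rw [Finset.prod_univ_sum]
    simp [dotProduct, Real.exp_sum]
  have h2 : ∀ i, ∑ x ∈ ({1, -1} : Finset ℝ), Real.exp (x * a i) ≤
      2 * Real.exp (a i * a i / 2) := by
    intro i
    rw [Finset.sum_pair (by norm_num)]
    have := Real.cosh_le_exp_half_sq (a i)
    rw [Real.cosh_eq, sq] at this
    simp only [one_mul, neg_one_mul]
    linarith
  rw [h1]
  refine (Finset.prod_le_prod (fun i _ => Finset.sum_nonneg fun x _ => (Real.exp_pos _).le)
    fun i _ => h2 i).trans_eq ?_
  rw [Finset.prod_mul_distrib, ← Real.exp_sum, dotProduct, Finset.sum_div]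
  simp

theorem sum_sum_exp_sign_le {ι : Type*} [Fintype ι] [DecidableEq ι] (A : Finset (ι → ℝ))
    {M b : ℝ} (hA : ∀ a ∈ A, a ⬝ᵥ a ≤ M) :
    ∑ ε ∈ Fintype.piFinset (fun _ : ι => ({1, -1} : Finset ℝ)), ∑ a ∈ A, Real.exp (b * (ε ⬝ᵥ a)) ≤
      2 ^ Fintype.card ι * (A.card * Real.exp (b ^ 2 * M / 2)) := by
  rw [Finset.sum_comm]
  have : ∀ a ∈ A, ∑ ε ∈ Fintype.piFinset (fun _ : ι => ({1, -1} : Finset ℝ)),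
      Real.exp (b * (ε ⬝ᵥ a)) ≤ 2 ^ Fintype.card ι * Real.exp (b ^ 2 * M / 2) := by
    intro a ha
    have h := sum_exp_sign_le (b • a)
    simp only [dotProduct_smul, smul_dotProduct, smul_eq_mul] at h
    refine h.trans ?_
    refine mul_le_mul_of_nonneg_left (Real.exp_le_exp.mpr ?_) (by positivity)
    nlinarith [mul_le_mul_of_nonneg_left (hA a ha) (sq_nonneg b)]
  refine (Finset.sum_le_sum this).trans_eq ?_
  simp
  ring

/-- The chosen parameter makes the last exponent `2 log N`; taking logarithms leaves `log 2 + 3 log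
N ≤ 4 log N`, where `2 ≤ N` is used. -/
theorem le_two_mul_sqrt_of_exp_le {x M N : ℝ} (hM : 0 < M) (hN : 2 ≤ N)
    (h : Real.exp (2 * √(Real.log N) / √M * x) ≤
      2 * (N * Real.exp ((2 * √(Real.log N) / √M) ^ 2 * M / 2))) :
    x ≤ 2 * √M * √(Real.log N) := by
  have hl : 0 < Real.log N := Real.log_pos (by linarith)
  have hlog2 : Real.log 2 ≤ Real.log N := Real.log_le_log (by norm_num) hN
  have hsM := Real.sqrt_pos.mpr hM
  have hsl := Real.sqrt_pos.mpr hl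
  have h1 : (2 * √(Real.log N) / √M) ^ 2 * M / 2 = 2 * Real.log N := by
    rw [div_pow, mul_pow, Real.sq_sqrt hl.le, Real.sq_sqrt hM.le]; field_simp
  rw [h1] at h
  have h2 := Real.log_le_log (Real.exp_pos _) h
  rw [Real.log_exp, Real.log_mul (by norm_num) (by positivity), Real.log_mul (by positivity)
    (by positivity), Real.log_exp] at h2
  have h3 : 2 * √(Real.log N) / √M * x ≤ 4 * Real.log N := by linarith
  have h4 : 2 * √(Real.log N) / √M * x = √(Real.log N) * (2 * x / √M) := by ring
  rw [h4] at h3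
  have h5 : √(Real.log N) * (2 * x / √M) ≤ √(Real.log N) * (4 * √(Real.log N)) := by
    refine h3.trans_eq ?_
    rw [mul_left_comm, Real.mul_self_sqrt hl.le]
  have h6 := le_of_mul_le_mul_left h5 hsl
  rw [div_le_iff₀ hsM] at h6
  linarith

/-- A sign vector on which two finite families of linear forms are simultaneously small. -/
theorem exists_sign_dotProduct_le {ι : Type*} [Fintype ι] [DecidableEq ι]
    (A B : Finset (ι → ℝ)) {M N : ℝ} (hM : 0 < M) (hN : 0 < N)
    (hA : ∀ a ∈ A, a ⬝ᵥ a ≤ M) (hB : ∀ b ∈ B, b ⬝ᵥ b ≤ N) (cA : 2 ≤ A.card) (cB : 2 ≤ B.card) :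
    ∃ ε : ι → ℝ, ε ⬝ᵥ ε = Fintype.card ι ∧
      (∀ a ∈ A, ε ⬝ᵥ a ≤ 2 * √M * √(Real.log A.card)) ∧
      ∀ b ∈ B, ε ⬝ᵥ b ≤ 2 * √N * √(Real.log B.card) := by
  have cA' : (2 : ℝ) ≤ A.card := by exact_mod_cast cA
  have cB' : (2 : ℝ) ≤ B.card := by exact_mod_cast cB
  set x := 2 * √(Real.log A.card) / √M
  set y := 2 * √(Real.log B.card) / √N
  set X := A.card * Real.exp (x ^ 2 * M / 2) with hX
  set Y := B.card * Real.exp (y ^ 2 * N / 2) with hY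
  have hX0 : 0 < X := by positivity
  have hY0 : 0 < Y := by positivity
  -- Each normalised sum has mean at most `1`, so one `ε` makes their total at most `2`, and both
  -- families are controlled at once.
  obtain ⟨ε, hε, h⟩ : ∃ ε ∈ Fintype.piFinset (fun _ : ι => ({1, -1} : Finset ℝ)),
      (∑ a ∈ A, Real.exp (x * (ε ⬝ᵥ a))) / X + (∑ b ∈ B, Real.exp (y * (ε ⬝ᵥ b))) / Y ≤ 2 := by
    refine Finset.exists_le_of_sum_le ⟨fun _ => 1, by simp⟩ ?_
    rw [Finset.sum_add_distrib, ← Finset.sum_div, ← Finset.sum_div]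
    have h1 := (div_le_iff₀ hX0).mpr (sum_sum_exp_sign_le A (b := x) hA)
    have h2 := (div_le_iff₀ hY0).mpr (sum_sum_exp_sign_le B (b := y) hB)
    refine (add_le_add h1 h2).trans_eq ?_
    simp [Fintype.card_piFinset]
    norm_num [Finset.card_pair]
    ring
  refine ⟨ε, ?_, fun a ha => ?_, fun b hb => ?_⟩
  · have : ∀ i, ε i * ε i = 1 := by
      intro i
      have := Fintype.mem_piFinset.mp hε i
      simp only [Finset.mem_insert, Finset.mem_singleton] at this
      rcases this with h | h <;> simp [h]
    simp [dotProduct, this]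
  · refine le_two_mul_sqrt_of_exp_le hM cA' ?_
    rw [← div_le_iff₀ hX0]
    refine (div_le_div_of_nonneg_right (Finset.single_le_sum
      (f := fun a => Real.exp (x * (ε ⬝ᵥ a))) (fun _ _ => (Real.exp_pos _).le) ha) hX0.le).trans ?_
    have : 0 ≤ (∑ b ∈ B, Real.exp (y * (ε ⬝ᵥ b))) / Y := by positivity
    linarith
  · refine le_two_mul_sqrt_of_exp_le hN cB' ?_
    rw [← div_le_iff₀ hY0]
    refine (div_le_div_of_nonneg_right (Finset.single_le_sum
      (f := fun b => Real.exp (y * (ε ⬝ᵥ b))) (fun _ _ => (Real.exp_pos _).le) hb) hY0.le).trans ?_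
    have : 0 ≤ (∑ a ∈ A, Real.exp (x * (ε ⬝ᵥ a))) / X := by positivity
    linarith

/-! ### Polar pairs of finite sets. -/

theorem exists_pos_forall_smul_dotProduct_le {ι : Type*} [Fintype ι] (V : Finset (ι → ℝ))
    (q : ι → ℝ) : ∃ δ : ℝ, 0 < δ ∧ ∀ v ∈ V, (δ • q) ⬝ᵥ v ≤ 1 := by
  have h0 : 0 ≤ ∑ v ∈ V, |q ⬝ᵥ v| := Finset.sum_nonneg fun _ _ => abs_nonneg _
  refine ⟨1 / (1 + ∑ v ∈ V, |q ⬝ᵥ v|), by positivity, fun v hv => ?_⟩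
  have h1 : |q ⬝ᵥ v| ≤ ∑ v ∈ V, |q ⬝ᵥ v| :=
    Finset.single_le_sum (f := fun v => |q ⬝ᵥ v|) (fun _ _ => abs_nonneg _) hv
  rw [smul_dotProduct, smul_eq_mul, div_mul_eq_mul_div, div_le_one (by positivity)]
  linarith [le_abs_self (q ⬝ᵥ v)]

/-- `U` and `V` are in polar position: the polars of `U` and of `V` are polar to each other. -/
def PolarPair {ι : Type*} [Fintype ι] (U V : Finset (ι → ℝ)) : Prop :=
  ∀ p q : ι → ℝ, (∀ v ∈ V, p ⬝ᵥ v ≤ 1) → (∀ u ∈ U, q ⬝ᵥ u ≤ 1) → p ⬝ᵥ q ≤ 1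

theorem PolarPair.symm {ι : Type*} [Fintype ι] {U V : Finset (ι → ℝ)} (h : PolarPair U V) :
    PolarPair V U := fun p q hp hq => by
  rw [dotProduct_comm]; exact h q p hq hp

/-- Otherwise every positive multiple of `q` is admissible against `U`, and pairing with a small `δ
• q` is unbounded; the multiple used below gives the value `2`. -/
theorem PolarPair.exists_dotProduct_pos {ι : Type*} [Fintype ι] {U V : Finset (ι → ℝ)}
    (h : PolarPair U V) {q : ι → ℝ} (hq : q ≠ 0) : ∃ u ∈ U, 0 < q ⬝ᵥ u := by
  by_contra! hu
  obtain ⟨δ, hδ, hV⟩ := exists_pos_forall_smul_dotProduct_le V q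
  have hqq : 0 < q ⬝ᵥ q := by simpa using dotProduct_star_self_pos_iff.mpr hq
  have hpos : 0 < δ * (q ⬝ᵥ q) := by positivity
  have := h (δ • q) ((2 / (δ * (q ⬝ᵥ q))) • q) hV fun u hu' => by
    rw [smul_dotProduct, smul_eq_mul]
    have h1 := hu u hu'
    have : 0 ≤ 2 / (δ * (q ⬝ᵥ q)) := by positivity
    nlinarith
  rw [smul_dotProduct, dotProduct_smul, smul_eq_mul, smul_eq_mul, mul_left_comm,
    div_mul_cancel₀ _ hpos.ne'] at this
  norm_num at this

theorem PolarPair.two_le_card {ι : Type*} [Fintype ι] [Nonempty ι] {U V : Finset (ι → ℝ)}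
    (h : PolarPair U V) : 2 ≤ U.card := by
  obtain ⟨u, hu, h1⟩ := h.exists_dotProduct_pos (one_ne_zero : (1 : ι → ℝ) ≠ 0)
  obtain ⟨w, hw, h2⟩ := h.exists_dotProduct_pos (neg_ne_zero.mpr (one_ne_zero : (1 : ι → ℝ) ≠ 0))
  refine Finset.one_lt_card.mpr ⟨u, hu, w, hw, ?_⟩
  rintro rfl
  rw [neg_dotProduct] at h2
  linarith

theorem PolarPair.exists_abs_le {ι : Type*} [Fintype ι] [DecidableEq ι] {U V : Finset (ι → ℝ)}
    (h : PolarPair U V) :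
    ∃ C : ℝ, ∀ q : ι → ℝ, (∀ u ∈ U, q ⬝ᵥ u ≤ 1) → ∀ i, |q i| ≤ C := by
  choose δ hδ hV using exists_pos_forall_smul_dotProduct_le (ι := ι) V
  refine ⟨∑ i, ((δ (Pi.single i 1))⁻¹ + (δ (Pi.single i (-1)))⁻¹), fun q hq i => ?_⟩
  have h1 := h _ q (hV (Pi.single i 1)) hq
  have h2 := h _ q (hV (Pi.single i (-1))) hq
  have p1 := hδ (Pi.single i 1)
  have p2 := hδ (Pi.single i (-1))
  rw [smul_dotProduct, single_dotProduct, smul_eq_mul, ← le_div_iff₀' p1, one_mul, one_div] at h1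
  rw [smul_dotProduct, single_dotProduct, smul_eq_mul, ← le_div_iff₀' p2, one_div] at h2
  refine le_trans ?_ (Finset.single_le_sum (fun i _ => (add_pos (inv_pos.mpr (hδ _))
    (inv_pos.mpr (hδ _))).le) (Finset.mem_univ i))
  have := inv_pos.mpr p1
  have := inv_pos.mpr p2
  exact abs_le.mpr ⟨by linarith, by linarith⟩

theorem PolarPair.dotProduct_le_mul {ι : Type*} [Fintype ι] {U V : Finset (ι → ℝ)}
    (h : PolarPair U V) {p q : ι → ℝ} {a b : ℝ} (ha : 0 < a) (hb : 0 < b)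
    (hp : ∀ v ∈ V, p ⬝ᵥ v ≤ a) (hq : ∀ u ∈ U, q ⬝ᵥ u ≤ b) : p ⬝ᵥ q ≤ a * b := by
  have := h (a⁻¹ • p) (b⁻¹ • q)
    (fun v hv => by
      rw [smul_dotProduct, smul_eq_mul, inv_mul_le_iff₀ ha, mul_one]; exact hp v hv)
    (fun u hu => by
      rw [smul_dotProduct, smul_eq_mul, inv_mul_le_iff₀ hb, mul_one]; exact hq u hu)
  rwa [smul_dotProduct, dotProduct_smul, smul_eq_mul, smul_eq_mul, inv_mul_le_iff₀ ha,
    inv_mul_le_iff₀ hb, mul_one, mul_comm] at this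

theorem PolarPair.card_le_log_mul_log {ι : Type*} [Fintype ι] [Nonempty ι] [DecidableEq ι]
    {U V : Finset (ι → ℝ)} (h : PolarPair U V) (hVU : ∀ v ∈ V, ∀ u ∈ U, (v ⬝ᵥ u) ^ 2 ≤ 1) :
    (Fintype.card ι : ℝ) ≤ 16 * (Real.log V.card * Real.log U.card) := by
  obtain ⟨T, hT, hTU, hTV⟩ := exists_john_matrix U V hVU h.exists_abs_le
  have cU := h.two_le_card
  have cV := h.symm.two_le_card
  have hn : (0 : ℝ) < Fintype.card ι := by exact_mod_cast Fintype.card_pos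
  have iU : Function.Injective fun u : ι → ℝ => Tᵀ *ᵥ u :=
    mulVec_injective_of_isUnit ((isUnit_iff_isUnit_det _).mpr (by rwa [det_transpose]))
  have iV : Function.Injective fun v : ι → ℝ => T⁻¹ *ᵥ v :=
    mulVec_injective_of_isUnit
      ((isUnit_iff_isUnit_det _).mpr (isUnit_nonsing_inv_det _ hT))
  obtain ⟨ε, hε, hεU, hεV⟩ := exists_sign_dotProduct_le
    (U.image fun u => Tᵀ *ᵥ u) (V.image fun v => T⁻¹ *ᵥ v) one_pos hn
    (by simpa using hTU) (by simpa using hTV)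
    (by rwa [Finset.card_image_of_injective _ iU])
    (by rwa [Finset.card_image_of_injective _ iV])
  rw [Finset.card_image_of_injective _ iU] at hεU
  rw [Finset.card_image_of_injective _ iV] at hεV
  have lU : 0 < Real.log U.card := Real.log_pos (by exact_mod_cast cU)
  have lV : 0 < Real.log V.card := Real.log_pos (by exact_mod_cast cV)
  have key := h.dotProduct_le_mul (p := ε ᵥ* T⁻¹) (q := T *ᵥ ε)
    (a := 2 * √(Fintype.card ι) * √(Real.log V.card)) (b := 2 * √1 * √(Real.log U.card))
    (by positivity) (by positivity)
    (fun v hv => by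
      rw [← dotProduct_mulVec]; exact hεV _ (Finset.mem_image_of_mem _ hv))
    (fun u hu => by
      rw [← vecMul_transpose, ← dotProduct_mulVec]; exact hεU _ (Finset.mem_image_of_mem _ hu))
  rw [← dotProduct_mulVec, mulVec_mulVec, nonsing_inv_mul _ hT, one_mulVec, hε,
    Real.sqrt_one] at key
  have k2 := pow_le_pow_left₀ hn.le key 2
  have k3 : (2 * √(Fintype.card ι) * √(Real.log V.card) * (2 * 1 * √(Real.log U.card))) ^ 2 =
      Fintype.card ι * (16 * (Real.log V.card * Real.log U.card)) := by
    rw [mul_pow, mul_pow, mul_pow, mul_pow, Real.sq_sqrt hn.le, Real.sq_sqrt lU.le,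
      Real.sq_sqrt lV.le]
    ring
  rw [k3, sq] at k2
  exact le_of_mul_le_mul_left k2 hn

/-! ### Vertices and faces of a polytope. -/

theorem extremePoints_finite_of_finite {E : Type*} [AddCommGroup E] [Module ℝ E] {s : Set E}
    (hs : s.Finite) : ((convexHull ℝ s).extremePoints ℝ).Finite :=
  hs.subset extremePoints_convexHull_subset

theorem convexHull_extremePoints_of_finite {E : Type*} [NormedAddCommGroup E] [NormedSpace ℝ E]
    {s : Set E} (hs : s.Finite) :
    convexHull ℝ ((convexHull ℝ s).extremePoints ℝ) = convexHull ℝ s := by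
  rw [← ((extremePoints_finite_of_finite hs).isClosed_convexHull ℝ).closure_eq,
    closure_convexHull_extremePoints (hs.isCompact_convexHull ℝ) (convex_convexHull ℝ s)]

/-- A vertex is strictly separated from the hull of the other vertices, which is closed because they
are finitely many. -/
theorem extremePoints_subset_exposedPoints_of_finite {E : Type*} [NormedAddCommGroup E]
    [NormedSpace ℝ E] {s : Set E} (hs : s.Finite) :
    (convexHull ℝ s).extremePoints ℝ ⊆ (convexHull ℝ s).exposedPoints ℝ := by
  intro v hv
  set V := (convexHull ℝ s).extremePoints ℝ with hV
  have hVf : V.Finite := extremePoints_finite_of_finite hs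
  have hconv : convexHull ℝ V = convexHull ℝ s := convexHull_extremePoints_of_finite hs
  have hnot : v ∉ convexHull ℝ (V \ {v}) := fun h =>
    ((convex_convexHull ℝ s).mem_extremePoints_iff_mem_sdiff_convexHull_sdiff.mp hv).2
      (convexHull_mono (Set.sdiff_subset_sdiff_left extremePoints_subset) h)
  obtain ⟨f, r, hf, hr⟩ := geometric_hahn_banach_closed_point (convex_convexHull ℝ (V \ {v}))
    ((hVf.subset Set.sdiff_subset).isClosed_convexHull ℝ) hnot
  have hle : ∀ x ∈ convexHull ℝ s, f x ≤ f v := by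
    rw [← hconv]
    refine fun x hx => convexHull_min (t := {x | f x ≤ f v}) (fun w hw => ?_)
      (convex_halfSpace_le f.isLinear _) hx
    by_cases hwv : w = v
    · rw [hwv]; exact le_refl (f v)
    · exact ((hf w (subset_convexHull ℝ _ ⟨hw, hwv⟩)).trans hr).le
  refine ⟨hv.1, f, fun x hx => ⟨hle x hx, fun hvx => ?_⟩⟩
  rw [← hconv, ← Set.insert_sdiff_self_of_mem hv] at hx
  rcases (V \ {v}).eq_empty_or_nonempty with he | hne
  · rw [he] at hx; simpa using hx
  rw [convexHull_insert hne, mem_convexJoin] at hx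
  obtain ⟨_, rfl, z, hz, a, b, ha, hb, hab, rfl⟩ := hx
  have hfz := (hf z hz).trans hr
  simp only [map_add, map_smul, smul_eq_mul] at hvx
  have hb0 : b = 0 := by
    have : a = 1 - b := by linarith
    rw [this] at hvx
    nlinarith
  have ha1 : a = 1 := by linarith
  simp [hb0, ha1]

theorem polytopeVertices_eq_extremePoints {n : ℕ} {P : Set (EuclideanSpace ℝ (Fin n))}
    (hP : IsPolytope P) : polytopeVertices P = P.extremePoints ℝ := by
  obtain ⟨⟨s, hs, rfl⟩, -⟩ := hP
  ext v
  refine ⟨fun h => exposedPoints_subset_extremePoints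
    (mem_exposedPoints_iff_exposed_singleton.mpr h.2), fun h => ⟨Set.singleton_nonempty v,
    mem_exposedPoints_iff_exposed_singleton.mp
      (extremePoints_subset_exposedPoints_of_finite hs h)⟩⟩

/-- A face is determined by its extreme points, which are among those of the polytope. -/
theorem polytopeFacets_finite {n : ℕ} {P : Set (EuclideanSpace ℝ (Fin n))}
    (hP : IsPolytope P) : (polytopeFacets P).Finite := by
  obtain ⟨⟨s, hs, rfl⟩, -⟩ := hP
  refine Set.Finite.of_injOn (f := fun F => F.extremePoints ℝ)
    (t := (((convexHull ℝ s).extremePoints ℝ).powerset)) (fun F hF => ?_) (fun F hF G hG h => ?_)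
    (extremePoints_finite_of_finite hs).finite_subsets
  · exact hF.1.2.isExtreme.extremePoints_subset_extremePoints
  · have hc := hs.isCompact_convexHull ℝ
    have hcv := convex_convexHull ℝ s
    have h' : F.extremePoints ℝ = G.extremePoints ℝ := h
    rw [← closure_convexHull_extremePoints (hF.1.2.isCompact hc) (hF.1.2.convex hcv),
      ← closure_convexHull_extremePoints (hG.1.2.isCompact hc) (hG.1.2.convex hcv), h']

/-! ### The polar body and its vertices. -/

/-- The one-sided polar of a set in an inner product space. -/
def innerPolar {E : Type*} [NormedAddCommGroup E] [InnerProductSpace ℝ E] (P : Set E) : Set E :=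
  {y | ∀ x ∈ P, ⟪x, y⟫ ≤ 1}

section Polar

variable {E : Type*} [NormedAddCommGroup E] [InnerProductSpace ℝ E]

theorem innerPolar_convexHull (s : Set E) : innerPolar (convexHull ℝ s) = innerPolar s := by
  ext y
  refine ⟨fun h x hx => h x (subset_convexHull ℝ s hx), fun h x hx => ?_⟩
  refine convexHull_min (t := {x | ⟪x, y⟫ ≤ 1}) h (convex_halfSpace_le ?_ 1) hx
  exact ⟨fun a b => inner_add_left a b y, fun c a => by simp [real_inner_smul_left]⟩

theorem convex_innerPolar (P : Set E) : Convex ℝ (innerPolar P) := by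
  intro y hy z hz a b ha hb hab x hx
  rw [inner_add_right, real_inner_smul_right, real_inner_smul_right]
  nlinarith [hy x hx, hz x hx]

theorem isClosed_innerPolar (P : Set E) : IsClosed (innerPolar P) := by
  have : innerPolar P = ⋂ x ∈ P, {y | ⟪x, y⟫ ≤ 1} := by ext; simp [innerPolar]
  rw [this]
  exact isClosed_biInter fun x _ => isClosed_le (by fun_prop) continuous_const

theorem isBounded_innerPolar {P : Set E} (h : P ∈ nhds 0) :
    Bornology.IsBounded (innerPolar P) := by
  obtain ⟨r, hr, hP⟩ := Metric.nhds_basis_closedBall.mem_iff.mp h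
  refine (Metric.isBounded_closedBall (x := (0 : E)) (r := r⁻¹)).subset fun y hy => ?_
  rw [mem_closedBall_zero_iff]
  rcases eq_or_ne y 0 with rfl | hy0
  · simp [hr.le]
  have hn : 0 < ‖y‖ := norm_pos_iff.mpr hy0
  have h1 := hy ((r * ‖y‖⁻¹) • y) (hP (by
    rw [mem_closedBall_zero_iff, norm_smul, norm_mul, norm_inv, norm_norm, mul_assoc,
      inv_mul_cancel₀ hn.ne', mul_one, Real.norm_of_nonneg hr.le]))
  rw [real_inner_smul_left, real_inner_self_eq_norm_sq, sq, mul_assoc,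
    inv_mul_cancel_left₀ hn.ne'] at h1
  rwa [← one_div, le_div_iff₀' hr]

theorem isCompact_innerPolar [FiniteDimensional ℝ E] {P : Set E} (h : P ∈ nhds 0) :
    IsCompact (innerPolar P) :=
  Metric.isCompact_of_isClosed_isBounded (isClosed_innerPolar P) (isBounded_innerPolar h)

theorem inner_le_one_of_forall_extremePoints_innerPolar [FiniteDimensional ℝ E] {P : Set E}
    (h : P ∈ nhds 0) {p q : E} (hp : p ∈ innerPolar P)
    (hq : ∀ u ∈ (innerPolar P).extremePoints ℝ, ⟪q, u⟫ ≤ 1) : ⟪q, p⟫ ≤ 1 := by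
  rw [← closure_convexHull_extremePoints (isCompact_innerPolar h) (convex_innerPolar P)] at hp
  refine closure_minimal (t := {p | ⟪q, p⟫ ≤ 1}) (convexHull_min hq (convex_halfSpace_le ?_ 1))
    (isClosed_le (by fun_prop) continuous_const) hp
  exact (innerSL ℝ q).isLinear

theorem mem_nhds_zero_of_symmetric {P : Set E} (hc : Convex ℝ P) (hi : (interior P).Nonempty)
    (hs : P = -P) : P ∈ nhds 0 := by
  obtain ⟨x, hx⟩ := hi
  obtain ⟨r, hr, hb⟩ := Metric.isOpen_iff.mp isOpen_interior x hx
  refine Filter.mem_of_superset (Metric.ball_mem_nhds 0 hr) fun y hy => ?_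
  have hy' : ‖y‖ < r := mem_ball_zero_iff.mp hy
  have h1 : x + y ∈ P := interior_subset (hb (by simpa [mem_ball_iff_norm] using hy'))
  have h2 : x - y ∈ P := interior_subset (hb (by simpa [mem_ball_iff_norm] using hy'))
  have h3 : -(x - y) ∈ P := by rw [hs]; simpa using h2
  have h4 := hc h1 h3 (a := 1 / 2) (b := 1 / 2) (by norm_num) (by norm_num) (by norm_num)
  convert h4 using 1
  module

/-- Were `d ≠ 0` orthogonal to all active `v`, both `y ± ε d` would stay in the polar for small `ε`,
so `y` would not be extreme. -/
theorem span_active_eq_top_of_mem_extremePoints_innerPolar [FiniteDimensional ℝ E] {V : Set E}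
    (hV : V.Finite) {y : E} (hy : y ∈ (innerPolar V).extremePoints ℝ) :
    Submodule.span ℝ {v ∈ V | ⟪v, y⟫ = 1} = ⊤ := by
  by_contra hne
  rw [← Submodule.orthogonal_eq_bot_iff, Submodule.eq_bot_iff] at hne
  push Not at hne
  obtain ⟨d, hd, hd0⟩ := hne
  have hev : ∀ᶠ ε : ℝ in nhds 0, ∀ v ∈ V, ⟪v, y + ε • d⟫ ≤ 1 := by
    rw [Filter.eventually_all_finite hV]
    intro v hv
    rcases (hy.1 v hv).eq_or_lt with h | h
    · have : ⟪v, d⟫ = 0 :=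
        Submodule.mem_orthogonal _ _ |>.mp hd v (Submodule.subset_span ⟨hv, h⟩)
      refine Filter.Eventually.of_forall fun ε => ?_
      rw [inner_add_right, real_inner_smul_right, this, h]
      simp
    · have hc : Continuous fun ε : ℝ => ⟪v, y + ε • d⟫ := by fun_prop
      have := hc.tendsto 0
      simp only [zero_smul, add_zero] at this
      exact (this.eventually_lt_const h).mono fun _ h => h.le
  have hev' : ∀ᶠ ε : ℝ in nhds 0, ∀ v ∈ V, ⟪v, y + (-ε) • d⟫ ≤ 1 := by
    have : Filter.Tendsto (fun ε : ℝ => -ε) (nhds 0) (nhds 0) := by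
      simpa using (continuous_neg (G := ℝ)).tendsto 0
    exact this.eventually hev
  obtain ⟨ε, ⟨h1, h2⟩, hε⟩ := (((hev.and hev').filter_mono nhdsWithin_le_nhds).and
    (self_mem_nhdsWithin (a := (0 : ℝ)) (s := Set.Ioi 0))).exists
  have h3 := hy.2 h1 h2 ⟨1 / 2, 1 / 2, by norm_num, by norm_num, by norm_num, by module⟩
  have : ε • d = 0 := by simpa using h3
  rcases smul_eq_zero.mp this with h | h
  · exact (ne_of_gt hε) h
  · exact hd0 h

end Polar

/-! ### From vertices of the polar to facets. -/

theorem mem_polytopeFacets_of_mem_extremePoints_innerPolar {n : ℕ} (hn : 1 ≤ n)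
    {V : Set (EuclideanSpace ℝ (Fin n))} (hV : V.Finite) {y : EuclideanSpace ℝ (Fin n)}
    (hy : y ∈ (innerPolar V).extremePoints ℝ) :
    {x ∈ convexHull ℝ V | ⟪x, y⟫ = 1} ∈ polytopeFacets (convexHull ℝ V) := by
  have hspan := span_active_eq_top_of_mem_extremePoints_innerPolar hV hy
  have hfin : Module.finrank ℝ (EuclideanSpace ℝ (Fin n)) = n := by simp
  have hnt : Nontrivial (EuclideanSpace ℝ (Fin n)) :=
    Module.nontrivial_of_finrank_pos (R := ℝ) (by omega)
  obtain ⟨a, haV, hay⟩ : {v ∈ V | ⟪v, y⟫ = 1}.Nonempty := by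
    rw [Set.nonempty_iff_ne_empty]
    intro h
    rw [h, Submodule.span_empty] at hspan
    exact bot_ne_top hspan
  have haF : a ∈ {x ∈ convexHull ℝ V | ⟪x, y⟫ = 1} := ⟨subset_convexHull ℝ V haV, hay⟩
  have hpol : ∀ x ∈ convexHull ℝ V, ⟪x, y⟫ ≤ 1 := by
    have := hy.1
    rwa [← innerPolar_convexHull] at this
  refine ⟨⟨⟨a, haF⟩, fun _ => ⟨innerSL ℝ y, ?_⟩⟩, ?_⟩
  · ext x
    simp only [Set.mem_ofPred_eq, innerSL_apply_apply, real_inner_comm _ y]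
    refine and_congr_right fun hx => ⟨fun h z hz => h ▸ hpol z hz, fun h => ?_⟩
    exact le_antisymm (hpol x hx) (hay ▸ h a haF.1)
  set F := {x ∈ convexHull ℝ V | ⟪x, y⟫ = 1} with hF
  have hlt : Module.finrank ℝ (vectorSpan ℝ F) < n := by
    refine (Submodule.finrank_lt fun htop => ?_).trans_eq hfin
    have hle : vectorSpan ℝ F ≤ (ℝ ∙ y)ᗮ := by
      rw [vectorSpan_def, Submodule.span_le]
      rintro _ ⟨p, hp, q, hq, rfl⟩
      rw [SetLike.mem_coe, Submodule.mem_orthogonal_singleton_iff_inner_left]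
      change ⟪p - q, y⟫ = 0
      rw [inner_sub_left, hp.2, hq.2, sub_self]
    rw [htop, top_le_iff, Submodule.orthogonal_eq_top_iff, Submodule.span_singleton_eq_bot] at hle
    rw [hle, inner_zero_right] at hay
    exact zero_ne_one hay
  -- Active points span the space, and each is `(v - a) + a`, so the directions of `F` lack at most
  -- one dimension.
  have hge : n ≤ Module.finrank ℝ (vectorSpan ℝ F) + 1 := by
    have htop : vectorSpan ℝ F ⊔ (ℝ ∙ a) = ⊤ := by
      rw [eq_top_iff, ← hspan, Submodule.span_le]
      rintro v ⟨hv, hvy⟩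
      have hvF : v ∈ F := ⟨subset_convexHull ℝ V hv, hvy⟩
      have := Submodule.add_mem_sup (vsub_mem_vectorSpan ℝ hvF haF)
        (Submodule.mem_span_singleton_self (R := ℝ) a)
      simpa using this
    have h1 := Submodule.finrank_add_le_finrank_add_finrank (vectorSpan ℝ F) (ℝ ∙ a)
    rw [htop, finrank_top, hfin] at h1
    exact h1.trans (by gcongr; simpa using finrank_span_le_card (R := ℝ) ({a} : Set (EuclideanSpace ℝ (Fin n))))
  unfold faceDim
  omega

theorem injOn_activeFace_extremePoints_innerPolar {E : Type*} [NormedAddCommGroup E]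
    [InnerProductSpace ℝ E] [FiniteDimensional ℝ E] {V : Set E} (hV : V.Finite) :
    Set.InjOn (fun y => {x ∈ convexHull ℝ V | ⟪x, y⟫ = 1}) ((innerPolar V).extremePoints ℝ) := by
  intro y hy z _ h
  have hspan := span_active_eq_top_of_mem_extremePoints_innerPolar hV hy
  have hle : Submodule.span ℝ {v ∈ V | ⟪v, y⟫ = 1} ≤ (ℝ ∙ (y - z))ᗮ := by
    rw [Submodule.span_le]
    rintro v ⟨hv, hvy⟩
    have hvz : v ∈ {x ∈ convexHull ℝ V | ⟪x, z⟫ = 1} := by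
      have h' : {x ∈ convexHull ℝ V | ⟪x, y⟫ = 1} = {x ∈ convexHull ℝ V | ⟪x, z⟫ = 1} := h
      rw [← h']
      exact ⟨subset_convexHull ℝ V hv, hvy⟩
    rw [SetLike.mem_coe, Submodule.mem_orthogonal_singleton_iff_inner_left, inner_sub_right,
      hvy, hvz.2, sub_self]
  rw [hspan, top_le_iff, Submodule.orthogonal_eq_top_iff, Submodule.span_singleton_eq_bot] at hle
  exact sub_eq_zero.mp hle

theorem polarPair_of_innerPolar {n : ℕ} {V U : Finset (EuclideanSpace ℝ (Fin n))}
    (h : ∀ p q : EuclideanSpace ℝ (Fin n), (∀ v ∈ V, ⟪v, p⟫ ≤ 1) → (∀ u ∈ U, ⟪q, u⟫ ≤ 1) →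
      ⟪q, p⟫ ≤ 1) :
    PolarPair (U.image WithLp.ofLp) (V.image WithLp.ofLp) := by
  intro p q hp hq
  have := h (WithLp.toLp 2 p) (WithLp.toLp 2 q)
    (fun v hv => by
      rw [EuclideanSpace.inner_eq_star_dotProduct]
      simpa using hp _ (Finset.mem_image_of_mem _ hv))
    (fun u hu => by
      rw [real_inner_comm, EuclideanSpace.inner_eq_star_dotProduct]
      simpa using hq _ (Finset.mem_image_of_mem _ hu))
  rw [EuclideanSpace.inner_eq_star_dotProduct] at this
  simpa using this

/-! ### The main inequality. -/

theorem corollary1p2 :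
    ∃ c : ℝ, 0 < c ∧ ∀ n : ℕ, 1 ≤ n → ∀ P : Set (EuclideanSpace ℝ (Fin n)),
      IsPolytope P → P = -P →
        c * (n : ℝ) ≤
          Real.log ((polytopeVertices P).ncard : ℝ) * Real.log ((polytopeFacets P).ncard : ℝ) := by
  refine ⟨1 / 16, by norm_num, fun n hn P hP hsymm => ?_⟩
  have : Nonempty (Fin n) := ⟨⟨0, hn⟩⟩
  have hFf := polytopeFacets_finite hP
  rw [polytopeVertices_eq_extremePoints hP]
  obtain ⟨⟨s, hs, hPs⟩, hi⟩ := hP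
  set V := P.extremePoints ℝ with hVdef
  have hV : V.Finite := by rw [hVdef, hPs]; exact extremePoints_finite_of_finite hs
  have hPV : P = convexHull ℝ V := by
    rw [hVdef, hPs]; exact (convexHull_extremePoints_of_finite hs).symm
  have h0 : P ∈ nhds 0 := mem_nhds_zero_of_symmetric (hPs ▸ convex_convexHull ℝ s) hi hsymm
  have hpol : innerPolar P = innerPolar V := by
    conv_lhs => rw [hPV, innerPolar_convexHull]
  set U := (innerPolar P).extremePoints ℝ with hU
  have hmaps : Set.MapsTo (fun y => {x ∈ convexHull ℝ V | ⟪x, y⟫ = 1}) U (polytopeFacets P) := by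
    intro y hy
    rw [hU, hpol] at hy
    have := mem_polytopeFacets_of_mem_extremePoints_innerPolar hn hV hy
    rw [← hPV] at this
    simpa only [← hPV] using this
  have hinj : Set.InjOn (fun y => {x ∈ convexHull ℝ V | ⟪x, y⟫ = 1}) U := by
    rw [hU, hpol]
    exact injOn_activeFace_extremePoints_innerPolar hV
  have hUf : U.Finite := Set.Finite.of_injOn hmaps hinj hFf
  have hcard : U.ncard ≤ (polytopeFacets P).ncard :=
    Set.ncard_le_ncard_of_injOn _ hmaps hinj hFf
  have hpair : PolarPair (hUf.toFinset.image WithLp.ofLp) (hV.toFinset.image WithLp.ofLp) := by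
    refine polarPair_of_innerPolar fun p q hp hq => ?_
    refine inner_le_one_of_forall_extremePoints_innerPolar h0 (p := p) ?_ (by simpa using hq)
    rw [hpol]
    simpa [innerPolar] using hp
  have hinjLp : Function.Injective
      (WithLp.ofLp : EuclideanSpace ℝ (Fin n) → (Fin n → ℝ)) := WithLp.ofLp_injective 2
  have hmain := hpair.card_le_log_mul_log (by
    simp only [Finset.mem_image, Set.Finite.mem_toFinset]
    rintro _ ⟨v, hv, rfl⟩ _ ⟨u, hu, rfl⟩
    have h1 : ∀ x ∈ P, ⟪x, u⟫ ≤ 1 := hu.1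
    have h2 := h1 v hv.1
    have h3 := h1 (-v) (by rw [hsymm]; simpa using hv.1)
    rw [inner_neg_left] at h3
    have h4 : ⟪v, u⟫ = v.ofLp ⬝ᵥ u.ofLp := by
      rw [real_inner_comm, EuclideanSpace.inner_eq_star_dotProduct]; simp
    rw [← h4, sq_le_one_iff_abs_le_one]
    exact abs_le.mpr ⟨by linarith, h2⟩)
  have cU := hpair.two_le_card
  rw [Finset.card_image_of_injective _ hinjLp, ← Set.ncard_eq_toFinset_card _ hUf] at cU
  rw [Finset.card_image_of_injective _ hinjLp, Finset.card_image_of_injective _ hinjLp,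
    ← Set.ncard_eq_toFinset_card _ hUf, ← Set.ncard_eq_toFinset_card _ hV, Fintype.card_fin] at hmain
  have hlog : Real.log U.ncard ≤ Real.log (polytopeFacets P).ncard :=
    Real.log_le_log (by exact_mod_cast (by omega : 0 < U.ncard)) (by exact_mod_cast hcard)
  have hVlog : 0 ≤ Real.log V.ncard := Real.log_natCast_nonneg _
  linarith [mul_le_mul_of_nonneg_left hlog hVlog]
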